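/- Let $n,m\ge 0$ be integers, let $X$ be a metric space, let $A\subset\mathbb R^{n+m}$ be a Lebesgue measurable set and let $f:A\to X$ be a Lipschitz map. For $E\subset X$ let $$\mathcal H^n_\infty(E)=\inf\Big\{\frac{\omega_n}{2^n}\sum_{i=1}^\infty(\operatorname{diam}A_i)^n:\ E\subset\bigcup_{i=1}^\infty A_i\Big\}$$ be the Hausdorff content, where $\omega_n$ is the volume of the unit ball in $\mathbb R^n$ (and empty sets $A_i$ contribute $0$ to the sum), and for $x\in A$ let $$\Theta^{*n}(f,x)=\limsup_{r\to0^+}\frac{\mathcal H^n_\infty(f(B(x,r)\cap A))}{\omega_n r^n}$$ be the upper $n$-density of $f$ at $x$. Suppose that $\Theta^{*n}(f,x)>0$ for Lebesgue almost every $x\in A$. Then for $\mathcal H^n$-almost every $x\in X$ the set $f^{-1}(x)\subset\mathbb R^{n+m}$ is countably $\mathcal H^m$-rectifiable, that is, there are sets $E_i\subset\mathbb R^m$ and Lipschitz maps $g_i:E_i\to\mathbb R^{n+m}$, $i\in\mathbb N$, such that $\mathcal H^m\big(f^{-1}(x)\setminus\bigcup_{i=1}^\infty g_i(E_i)\big)=0$.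 Here $\mathcal H^d$ denotes $d$-dimensional Hausdorff measure. -/

import Mathlib

open MeasureTheory Filter Topology
open scoped NNReal ENNReal

noncomputable section

/-- The volume `ω_n` of the unit ball of `ℝⁿ`. -/
def unitBallVolume (n : ℕ) : ℝ≥0∞ :=
  volume (Metric.ball (0 : EuclideanSpace ℝ (Fin n)) 1)

/-- The `n`-dimensional Hausdorff content: the infimum of `(ω_n / 2ⁿ) ∑ (diam tᵢ)ⁿ` over all
countable coverings of `E`. Empty covering sets contribute `0`, which matters only for `n = 0`. -/
def hausdorffContent {X : Type*} [MetricSpace X] (n : ℕ) (E : Set X) : ℝ≥0∞ :=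
  ⨅ (t : ℕ → Set X) (_ : E ⊆ ⋃ i, t i),
    unitBallVolume n / 2 ^ n * ∑' i, ⨆ _ : (t i).Nonempty, Metric.ediam (t i) ^ n

/-- The upper `n`-density `Θ^{*n}(f, x)` of a map `f : A → X`, `A ⊆ ℝᵏ`, at a point `x ∈ A`. -/
def upperDensity {X : Type*} [MetricSpace X] (n : ℕ) {k : ℕ}
    {A : Set (EuclideanSpace ℝ (Fin k))} (f : A → X) (x : A) : ℝ≥0∞ :=
  limsup (fun r : ℝ =>
      hausdorffContent n (f '' {y : A | (y : EuclideanSpace ℝ (Fin k)) ∈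
          Metric.ball (x : EuclideanSpace ℝ (Fin k)) r}) /
        (unitBallVolume n * ENNReal.ofReal r ^ n))
    (𝓝[>] 0)

/-- `E ⊆ ℝᵏ` is countably `𝓗^m`-rectifiable: up to an `𝓗^m`-null set it is covered by the images
of countably many Lipschitz maps `g i : S i → ℝᵏ` defined on subsets `S i` of `ℝᵐ`. -/
def CountablyRectifiable (m : ℕ) {k : ℕ} (E : Set (EuclideanSpace ℝ (Fin k))) : Prop :=
  ∃ (S : ℕ → Set (EuclideanSpace ℝ (Fin m)))
    (g : ℕ → EuclideanSpace ℝ (Fin m) → EuclideanSpace ℝ (Fin k)),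
    (∀ i, ∃ K : ℝ≥0, LipschitzOnWith K (g i) (S i)) ∧
      Measure.hausdorffMeasure (m : ℝ) (E \ ⋃ i, g i '' S i) = 0

end

/-! The distances from `f` to its values on a dense sequence, extended to Lipschitz functions `φ j`
on the whole Euclidean space, act as coordinates: they are a.e. differentiable and the supremum of
their increments recovers distances in `X`.

Positive density forces rank at least `n`. Let `n = p + 1` and suppose that the derivatives of all
`φ j` at `x` share a kernel of dimension greater than `m`. For a.e. such `x`, `f` oscillates little
near `x` along the kernel, so subdividing only the `p` remaining directions covers the image of
`B(x, r)` by `(2N)^p` sets of diameter `O(r / N)`. Its content is `O(r ^ n / N)` for every `N`, and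
the density vanishes (`ae_upperDensity_eq_zero`). Differentiability is not uniform in `j`; the
uniform oscillation bound comes instead from Lebesgue density of a set of small derivatives, Fubini,
and integration along segments (`abs_sub_le_of_inner_le`).

Hence at a.e. point finitely many `φ j` already have a common kernel of dimension at most `m`.
Countably many pieces then carry a good linear approximation of these finite coordinate maps, and on
each piece every fibre is a Lipschitz graph over a subset of `ℝᵐ`
(`exists_decomposition_of_upperDensity_pos`).

The null set left over meets almost every fibre in an `𝓗ᵐ`-null set, by an Eilenberg-type inequality
proved by counting separated points (`ae_hausdorffMeasure_fiber_eq_zero`). -/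

/-! ### Hausdorff premeasures, coverings and packings. -/

/-- The size-`δ` Hausdorff outer measure of dimension `d`, computed with covers by sets of diameter
at most `δ`. -/
noncomputable def hausdorffPre {X : Type*} [EMetricSpace X] (d : ℕ) (δ : ℝ≥0∞) : OuterMeasure X :=
  OuterMeasure.mkMetric'.pre (fun s => Metric.ediam s ^ (d : ℝ)) δ

theorem hausdorffPre_anti {X : Type*} [EMetricSpace X] (d : ℕ) {δ δ' : ℝ≥0∞} (h : δ ≤ δ')
    (s : Set X) : hausdorffPre d δ' s ≤ hausdorffPre d δ s :=
  OuterMeasure.mkMetric'.mono_pre _ h s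

theorem tendsto_hausdorffPre {X : Type*} [EMetricSpace X] [MeasurableSpace X] [BorelSpace X]
    (d : ℕ) (s : Set X) :
    Tendsto (fun k : ℕ => hausdorffPre d (k : ℝ≥0∞)⁻¹ s) atTop
      (𝓝 (Measure.hausdorffMeasure (d : ℝ) s)) := by
  have h := OuterMeasure.mkMetric'.tendsto_pre_nat (fun s : Set X => Metric.ediam s ^ (d : ℝ)) s
  have e : Measure.hausdorffMeasure (d : ℝ) s
      = OuterMeasure.mkMetric' (fun s : Set X => Metric.ediam s ^ (d : ℝ)) s :=
    congrFun (OuterMeasure.coe_mkMetric (X := X) (fun r => r ^ (d : ℝ))).symm s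
  rw [e]
  exact h

theorem hausdorffMeasure_eq_zero_iff_hausdorffPre {X : Type*} [EMetricSpace X] [MeasurableSpace X]
    [BorelSpace X] (d : ℕ) (s : Set X) :
    Measure.hausdorffMeasure (d : ℝ) s = 0 ↔ ∀ k : ℕ, hausdorffPre d (k : ℝ≥0∞)⁻¹ s = 0 := by
  have ht := tendsto_hausdorffPre d s
  have hm : Monotone fun k : ℕ => hausdorffPre d (k : ℝ≥0∞)⁻¹ s := fun k l h =>
    hausdorffPre_anti d (by simpa using h) s
  refine ⟨fun h k => ?_, fun h => ?_⟩
  · rw [h] at ht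
    exact nonpos_iff_eq_zero.1 (hm.ge_of_tendsto ht k)
  · simp only [h] at ht
    exact tendsto_nhds_unique ht tendsto_const_nhds

theorem natCast_mul_two_mul_ofReal_pow (k d : ℕ) {ρ : ℝ} (hρ : 0 ≤ ρ) :
    (k : ℝ≥0∞) * (2 * ENNReal.ofReal ρ) ^ d = ENNReal.ofReal (k * (2 * ρ) ^ d) := by
  rw [ENNReal.ofReal_mul (by positivity), ENNReal.ofReal_pow (by positivity),
    ENNReal.ofReal_mul (by positivity)]
  simp

theorem hausdorffPre_le_of_subset_closedBall {X : Type*} [MetricSpace X] (d : ℕ) {δ : ℝ≥0∞}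
    {F : Set X} {P : Finset X} {ρ : ℝ} (hF : F ⊆ ⋃ a ∈ P, Metric.closedBall a ρ)
    (hδ : 2 * ENNReal.ofReal ρ ≤ δ) :
    hausdorffPre d δ F ≤ P.card * (2 * ENNReal.ofReal ρ) ^ d := by
  have hb : ∀ a : X, Metric.ediam (Metric.closedBall a ρ) ≤ 2 * ENNReal.ofReal ρ := fun a => by
    refine Metric.ediam_le fun x hx y hy => ?_
    rw [two_mul]
    refine (edist_triangle_right x y a).trans (add_le_add ?_ ?_) <;> rw [edist_dist]
    exacts [ENNReal.ofReal_le_ofReal hx, ENNReal.ofReal_le_ofReal hy]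
  calc hausdorffPre d δ F ≤ hausdorffPre d δ (⋃ a ∈ P, Metric.closedBall a ρ) := measure_mono hF
    _ ≤ ∑ a ∈ P, hausdorffPre d δ (Metric.closedBall a ρ) := measure_biUnion_finset_le _ _
    _ ≤ ∑ a ∈ P, (2 * ENNReal.ofReal ρ) ^ d := by
        refine Finset.sum_le_sum fun a _ => ?_
        refine (OuterMeasure.mkMetric'.pre_le ((hb a).trans hδ)).trans ?_
        rw [ENNReal.rpow_natCast]
        gcongr
        exact hb a
    _ = P.card * (2 * ENNReal.ofReal ρ) ^ d := by simp

/-- Greedy selection: a separated set whose closed balls fail to cover can be enlarged by an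
uncovered point. -/
theorem exists_finset_separated_or_cover {X : Type*} [MetricSpace X] (F : Set X) {ρ : ℝ}
    (hρ : 0 ≤ ρ) (k : ℕ) :
    (∃ P : Finset X, ↑P ⊆ F ∧ P.card = k ∧ ∀ a ∈ P, ∀ b ∈ P, a ≠ b → ρ < dist a b) ∨
      ∃ P : Finset X, P.card < k ∧ F ⊆ ⋃ a ∈ P, Metric.closedBall a ρ := by
  classical
  induction k with
  | zero => exact Or.inl ⟨∅, by simp⟩
  | succ k ih =>
    rcases ih with ⟨P, hPF, hPk, hP⟩ | ⟨P, hPk, hP⟩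
    · by_cases hc : F ⊆ ⋃ a ∈ P, Metric.closedBall a ρ
      · exact Or.inr ⟨P, by lia, hc⟩
      · obtain ⟨x, hxF, hx⟩ := Set.not_subset.1 hc
        simp only [Set.mem_iUnion, Metric.mem_closedBall, not_exists, not_le] at hx
        have hxP : x ∉ P := fun h => (hx x h).not_ge (by rwa [dist_self])
        refine Or.inl ⟨insert x P, ?_, ?_, ?_⟩
        · simp [Set.insert_subset_iff, hxF, hPF]
        · rw [Finset.card_insert_of_notMem hxP, hPk]
        · intro a ha b hb hab
          rcases Finset.mem_insert.1 ha with rfl | ha' <;>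
            rcases Finset.mem_insert.1 hb with rfl | hb'
          · exact absurd rfl hab
          · exact hx b hb'
          · rw [dist_comm]; exact hx a ha'
          · exact hP a ha' b hb' hab
    · exact Or.inr ⟨P, by lia, hP⟩

theorem unitBallVolume_ne_top (D : ℕ) : unitBallVolume D ≠ ∞ := measure_ball_lt_top.ne

theorem unitBallVolume_ne_zero (D : ℕ) : unitBallVolume D ≠ 0 :=
  (Metric.measure_ball_pos _ _ one_pos).ne'

theorem unitBallVolume_toReal_pos (D : ℕ) : 0 < (unitBallVolume D).toReal :=
  ENNReal.toReal_pos (unitBallVolume_ne_zero D) (unitBallVolume_ne_top D)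

theorem card_mul_volume_ball_le {D : ℕ} {W : Set (EuclideanSpace ℝ (Fin D))}
    (hW : volume W ≠ ∞) {ρ : ℝ} (hρ : 0 < ρ) (Q : Finset (EuclideanSpace ℝ (Fin D)))
    (hQ : ∀ a ∈ Q, ∀ b ∈ Q, a ≠ b → ρ < dist a b) (hQW : ∀ a ∈ Q, Metric.ball a ρ ⊆ W) :
    Q.card * ((ρ / 2) ^ D * (unitBallVolume D).toReal) ≤ (volume W).toReal := by
  have hb : ∀ a : EuclideanSpace ℝ (Fin D), volume (Metric.ball a (ρ / 2))
      = ENNReal.ofReal ((ρ / 2) ^ D) * unitBallVolume D := fun a => by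
    rw [Measure.addHaar_ball_of_pos _ _ (by positivity)]
    simp [unitBallVolume]
  have hsum : ∑ a ∈ Q, volume (Metric.ball a (ρ / 2)) ≤ volume W := by
    rw [← measure_biUnion_finset _ fun a _ => Metric.isOpen_ball.measurableSet]
    · exact measure_mono (Set.iUnion₂_subset fun a ha =>
        (Metric.ball_subset_ball (by linarith)).trans (hQW a ha))
    · intro a ha b hb hab
      exact Metric.ball_disjoint_ball (by linarith [hQ a ha b hb hab])
  simp only [hb, Finset.sum_const, nsmul_eq_mul] at hsum
  have := ENNReal.toReal_mono hW hsum
  rwa [ENNReal.toReal_mul, ENNReal.toReal_mul, ENNReal.toReal_natCast,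
    ENNReal.toReal_ofReal (by positivity)] at this

/-! ### Fibres over a null domain. -/

/-- A one-scale Eilenberg inequality. Large fibres contain many `ρ`-separated points, and fibres
over `Lρ`-separated values are `ρ` apart, so the volume of `W` limits how many such values there
are. -/
theorem hausdorffPre_large_fibers_le (n m : ℕ) {X : Type*} [MetricSpace X]
    {A : Set (EuclideanSpace ℝ (Fin (n + m)))} {f : A → X} {L : ℝ≥0} (hf : LipschitzWith L f)
    (hL : 1 ≤ L) {S W : Set (EuclideanSpace ℝ (Fin (n + m)))} {ρ s : ℝ} (hρ : 0 < ρ) (hs : 0 < s)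
    {δ : ℝ≥0∞} (hδ : 2 * ENNReal.ofReal (L * ρ) ≤ δ) (hSW : ∀ a ∈ S, Metric.ball a ρ ⊆ W)
    (hW : volume W ≠ ∞) :
    hausdorffPre n δ {x | ENNReal.ofReal s < hausdorffPre m δ
        ((Subtype.val : A → EuclideanSpace ℝ (Fin (n + m))) '' (f ⁻¹' {x}) ∩ S)} ≤
      ENNReal.ofReal (4 ^ (n + m) * L ^ n / (unitBallVolume (n + m)).toReal
        * (volume W).toReal / s) := by
  classical
  set T : Set X := {x | ENNReal.ofReal s < hausdorffPre m δ
        ((Subtype.val : A → EuclideanSpace ℝ (Fin (n + m))) '' (f ⁻¹' {x}) ∩ S)} with hT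
  set ω := (unitBallVolume (n + m)).toReal
  have hω : 0 < ω := unitBallVolume_toReal_pos _
  set w := (volume W).toReal
  have hw : 0 ≤ w := ENNReal.toReal_nonneg
  have hL0 : (1 : ℝ) ≤ L := by exact_mod_cast hL
  have hLρ : 0 < L * ρ := by positivity
  have hδ' : 2 * ENNReal.ofReal ρ ≤ δ := by
    refine le_trans ?_ hδ
    gcongr
    nlinarith
  -- Fewer than `k` balls of radius `ρ` would bound the premeasure of the fibre by `s`.
  set k := ⌈s / (2 * ρ) ^ m⌉₊ with hk
  have hk1 : s / (2 * ρ) ^ m ≤ k := Nat.le_ceil _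
  have hk0 : (0 : ℝ) < k := lt_of_lt_of_le (by positivity) hk1
  have hpack : ∀ x ∈ T, ∃ P : Finset (EuclideanSpace ℝ (Fin (n + m))),
      ↑P ⊆ (Subtype.val : A → EuclideanSpace ℝ (Fin (n + m))) '' (f ⁻¹' {x}) ∩ S ∧ P.card = k ∧
      ∀ a ∈ P, ∀ b ∈ P, a ≠ b → ρ < dist a b := by
    intro x hx
    refine (exists_finset_separated_or_cover _ hρ.le k).resolve_right ?_
    rintro ⟨P, hPk, hP⟩
    refine (lt_of_lt_of_le hx (hausdorffPre_le_of_subset_closedBall m hP hδ')).not_ge ?_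
    have h1 : (P.card : ℝ) < s / (2 * ρ) ^ m := Nat.lt_ceil.1 hPk
    have h2 : (P.card : ℝ) * (2 * ρ) ^ m ≤ s := by
      rw [lt_div_iff₀ (by positivity)] at h1
      exact h1.le
    calc (P.card : ℝ≥0∞) * (2 * ENNReal.ofReal ρ) ^ m
        = ENNReal.ofReal (P.card * (2 * ρ) ^ m) :=
          natCast_mul_two_mul_ofReal_pow _ _ (by positivity)
      _ ≤ ENNReal.ofReal s := ENNReal.ofReal_le_ofReal h2
  choose! P hPsub hPcard hPsep using hpack
  have hval : ∀ x ∈ T, ∀ a ∈ P x, ∃ h : a ∈ A, f ⟨a, h⟩ = x := by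
    intro x hx a ha
    obtain ⟨⟨y, hy, rfl⟩, -⟩ := hPsub x hx ha
    exact ⟨y.2, hy⟩
  have hsep : ∀ x ∈ T, ∀ y ∈ T, L * ρ < dist x y → ∀ a ∈ P x, ∀ b ∈ P y, ρ < dist a b := by
    intro x hx y hy hxy a ha b hb
    obtain ⟨ha', rfl⟩ := hval x hx a ha
    obtain ⟨hb', rfl⟩ := hval y hy b hb
    have := hxy.trans_le (hf.dist_le_mul ⟨a, ha'⟩ ⟨b, hb'⟩)
    exact lt_of_mul_lt_mul_left this (by positivity)
  -- The packing bound: each value uses `k` disjoint balls of radius `ρ / 2` inside `W`.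
  set c := w / (k * ((ρ / 2) ^ (n + m) * ω)) with hc
  have hc0 : 0 ≤ c := by positivity
  rcases exists_finset_separated_or_cover T hLρ.le (⌊c⌋₊ + 1) with ⟨R, hRT, hRc, hR⟩ | ⟨R, hRc, hR⟩
  · exfalso
    have hdisj : (R : Set X).PairwiseDisjoint P := by
      intro x hx y hy hxy
      rw [Function.onFun, Finset.disjoint_left]
      intro a ha hb
      obtain ⟨_, h1⟩ := hval x (hRT hx) a ha
      obtain ⟨_, h2⟩ := hval y (hRT hy) a hb
      exact hxy (h1.symm.trans h2)
    have hcard : (R.biUnion P).card = (⌊c⌋₊ + 1) * k := by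
      rw [Finset.card_biUnion hdisj, Finset.sum_congr rfl fun x hx => hPcard x (hRT hx)]
      simp [hRc]
    have h := card_mul_volume_ball_le hW hρ (R.biUnion P) (by
      intro a ha b hb hab
      obtain ⟨x, hx, ha⟩ := Finset.mem_biUnion.1 ha
      obtain ⟨y, hy, hb⟩ := Finset.mem_biUnion.1 hb
      by_cases hxy : x = y
      · subst hxy
        exact hPsep x (hRT hx) a ha b hb hab
      · exact hsep x (hRT hx) y (hRT hy) (hR x hx y hy hxy) a ha b hb) (by
      intro a ha
      obtain ⟨x, hx, ha⟩ := Finset.mem_biUnion.1 ha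
      exact hSW a (hPsub x (hRT hx) ha).2)
    rw [hcard] at h
    have h2 := Nat.lt_floor_add_one c
    rw [hc, div_lt_iff₀ (by positivity)] at h2
    push_cast at h
    exact absurd h (not_le.2 (by rw [mul_assoc]; exact h2))
  · refine (hausdorffPre_le_of_subset_closedBall n hR hδ).trans ?_
    have h1 : (R.card : ℝ) ≤ c :=
      (Nat.cast_le.2 (Nat.lt_succ_iff.1 hRc)).trans (Nat.floor_le hc0)
    calc (R.card : ℝ≥0∞) * (2 * ENNReal.ofReal (L * ρ)) ^ n
        = ENNReal.ofReal (R.card * (2 * (L * ρ)) ^ n) :=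
          natCast_mul_two_mul_ofReal_pow _ _ (by positivity)
      _ ≤ _ := by
        refine ENNReal.ofReal_le_ofReal ?_
        calc (R.card : ℝ) * (2 * (L * ρ)) ^ n ≤ c * (2 * (L * ρ)) ^ n := by gcongr
          _ ≤ w / (s / (2 * ρ) ^ m * ((ρ / 2) ^ (n + m) * ω)) * (2 * (L * ρ)) ^ n := by
            rw [hc]; gcongr
          _ = 4 ^ (n + m) * L ^ n / ω * w / s := by
            rw [show (4 : ℝ) = 2 * 2 by norm_num]
            simp only [mul_pow, div_pow, pow_add]
            field_simp

/-- A null set is exhausted by pieces `S l` whose `ρ l`-neighbourhoods have summably small measure. -/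
theorem exists_thickening_decomposition {D : ℕ} {A : Set (EuclideanSpace ℝ (Fin D))}
    (hA : volume A = 0) {ε r : ℝ} (hε : 0 < ε) (hr : 0 < r) :
    ∃ (S W : ℕ → Set (EuclideanSpace ℝ (Fin D))) (ρ : ℕ → ℝ), A ⊆ ⋃ l, S l ∧
      ∀ l, 0 < ρ l ∧ ρ l ≤ r ∧ (∀ a ∈ S l, Metric.ball a (ρ l) ⊆ W l) ∧
        volume (W l) ≤ ENNReal.ofReal (ε * (1 / 4) ^ l) := by
  obtain ⟨U, hAU, hUo, hU⟩ := A.exists_isOpen_lt_of_lt (μ := volume) (ENNReal.ofReal ε)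
    (by simpa [hA] using hε)
  set ν := (volume : Measure (EuclideanSpace ℝ (Fin D))).restrict U with hν
  have hνfin : IsFiniteMeasure ν := ⟨by simpa [hν] using hU.trans ENNReal.ofReal_lt_top⟩
  have hlim : Tendsto (fun r => ν (Metric.thickening r Uᶜ)) (𝓝[>] 0) (𝓝 0) := by
    have := tendsto_measure_thickening_of_isClosed (μ := ν) (s := Uᶜ)
      ⟨1, one_pos, measure_ne_top _ _⟩ hUo.isClosed_compl
    rwa [hν, Measure.restrict_apply hUo.measurableSet.compl, Set.compl_inter_self,
      measure_empty] at this
  have hseq : Tendsto (fun k : ℕ => (1 / 2 : ℝ) ^ k) atTop (𝓝[>] 0) :=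
    tendsto_nhdsWithin_iff.2 ⟨tendsto_pow_atTop_nhds_zero_of_lt_one (by norm_num) (by norm_num),
      Eventually.of_forall fun k => Set.mem_Ioi.2 (by positivity)⟩
  have hseq2 : Tendsto (fun k : ℕ => 2 * (1 / 2 : ℝ) ^ k) atTop (𝓝[>] 0) :=
    tendsto_nhdsWithin_iff.2 ⟨by
      simpa using (tendsto_nhdsWithin_iff.1 hseq).1.const_mul 2,
      Eventually.of_forall fun k => Set.mem_Ioi.2 (by positivity)⟩
  have hev : ∀ l : ℕ, ∀ᶠ k : ℕ in atTop, (1 / 2 : ℝ) ^ k ≤ r ∧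
      ν (Metric.thickening (2 * (1 / 2 : ℝ) ^ k) Uᶜ) ≤ ENNReal.ofReal (ε * (1 / 4) ^ (l + 1)) := by
    intro l
    refine ((tendsto_nhdsWithin_iff.1 hseq).1.eventually_le_const hr).and ?_
    exact (hlim.comp hseq2).eventually_le_const (by simpa using by positivity)
  obtain ⟨φ, hφ, hφp⟩ := extraction_forall_of_eventually hev
  set ρ : ℕ → ℝ := fun l => (1 / 2 : ℝ) ^ φ l with hρdef
  have hρ0 : ∀ l, 0 < ρ l := fun l => by positivity
  have hballU : ∀ {a : EuclideanSpace ℝ (Fin D)} {t : ℝ}, a ∉ Metric.thickening t Uᶜ →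
      Metric.ball a t ⊆ U := by
    intro a t ha y hy
    by_contra hyU
    exact ha (Metric.mem_thickening_iff.2 ⟨y, hyU, by rwa [dist_comm]⟩)
  -- `S l` collects the points for which `l` is the first index with distance to `Uᶜ` at least `ρ
  -- l`. The clause on `l'` is void for `l = 0`. The factor `2` in `W` absorbs a ball of radius `ρ
  -- (l' + 1) ≤ ρ l'`.
  refine ⟨fun l => {a | a ∈ A ∧ a ∉ Metric.thickening (ρ l) Uᶜ ∧
      ∀ l', l = l' + 1 → a ∈ Metric.thickening (ρ l') Uᶜ},
    fun l => {a | a ∈ U ∧ ∀ l', l = l' + 1 → a ∈ Metric.thickening (2 * ρ l') Uᶜ}, ρ, ?_, ?_⟩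
  · intro a ha
    have hex : ∃ l, a ∉ Metric.thickening (ρ l) Uᶜ := by
      obtain ⟨t, ht, htU⟩ := Metric.isOpen_iff.1 hUo a (hAU ha)
      obtain ⟨l, hl⟩ := (((tendsto_nhdsWithin_iff.1 hseq).1.comp hφ.tendsto_atTop).eventually_lt_const
        ht).exists
      refine ⟨l, fun h => ?_⟩
      obtain ⟨y, hy, hyd⟩ := Metric.mem_thickening_iff.1 h
      exact hy (htU (by rw [Metric.mem_ball, dist_comm]; exact hyd.trans hl))
    classical
    refine Set.mem_iUnion.2 ⟨Nat.find hex, ha, Nat.find_spec hex, fun l' hl' => ?_⟩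
    exact not_not.1 (Nat.find_min hex (m := l') (hl'.symm ▸ Nat.lt_succ_self l'))
  · intro l
    refine ⟨hρ0 l, (hφp l).1, ?_, ?_⟩
    · rintro a ⟨haA, ha, ha'⟩ y hy
      refine ⟨hballU ha hy, ?_⟩
      rintro l' rfl
      obtain ⟨z, hz, hzd⟩ := Metric.mem_thickening_iff.1 (ha' l' rfl)
      refine Metric.mem_thickening_iff.2 ⟨z, hz, ?_⟩
      have h1 : ρ (l' + 1) ≤ ρ l' :=
        pow_le_pow_of_le_one (by norm_num) (by norm_num) (hφ.monotone (Nat.le_succ l'))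
      have := dist_triangle y a z
      have := Metric.mem_ball.1 hy
      linarith
    · rcases l with _ | l
      · simpa using hU.le
      · refine le_trans ?_ (hφp l).2
        rw [hν, Measure.restrict_apply Metric.isOpen_thickening.measurableSet]
        exact measure_mono fun a ha => ⟨ha.2 l rfl, ha.1⟩

/-- A null set may be dense, so no single scale works. Each piece `S l` has its own scale; the
threshold is split as `s = ∑ s / 2 ^ (l + 1)`, and the volumes `ε / 4 ^ l` still beat these
thresholds summably. -/
theorem hausdorffPre_large_fibers_eq_zero (n m : ℕ) {X : Type*} [MetricSpace X]
    {A : Set (EuclideanSpace ℝ (Fin (n + m)))} {f : A → X} {L : ℝ≥0} (hf : LipschitzWith L f)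
    (hL : 1 ≤ L) (hA : volume A = 0) {s : ℝ} (hs : 0 < s) {δ : ℝ≥0∞} (hδ : 0 < δ) :
    hausdorffPre n δ {x | ENNReal.ofReal s < hausdorffPre m δ
        ((Subtype.val : A → EuclideanSpace ℝ (Fin (n + m))) '' (f ⁻¹' {x}))} = 0 := by
  set C : ℝ := 4 ^ (n + m) * L ^ n / (unitBallVolume (n + m)).toReal with hC
  have hL0 : (1 : ℝ) ≤ L := by exact_mod_cast hL
  have hC0 : 0 ≤ C := by positivity
  obtain ⟨r, hr, hrδ⟩ : ∃ r : ℝ, 0 < r ∧ 2 * ENNReal.ofReal (L * r) ≤ δ := by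
    rcases eq_or_ne δ ∞ with rfl | hδt
    · exact ⟨1, one_pos, le_top⟩
    refine ⟨δ.toReal / (2 * L), div_pos (ENNReal.toReal_pos hδ.ne' hδt) (by positivity), ?_⟩
    rw [show (2 : ℝ≥0∞) = ENNReal.ofReal 2 by simp, ← ENNReal.ofReal_mul (by norm_num),
      show 2 * (L * (δ.toReal / (2 * L))) = δ.toReal by field_simp, ENNReal.ofReal_toReal hδt]
  have key : ∀ ε : ℝ, 0 < ε → hausdorffPre n δ {x | ENNReal.ofReal s < hausdorffPre m δ
        ((Subtype.val : A → EuclideanSpace ℝ (Fin (n + m))) '' (f ⁻¹' {x}))}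
        ≤ ENNReal.ofReal (ε * (4 * C / s)) := by
    intro ε hε
    obtain ⟨S, W, ρ, hAS, h⟩ := exists_thickening_decomposition hA hε hr
    have hsl : ∀ l : ℕ, 0 < s / 2 / 2 ^ l := fun l => by positivity
    have hgeom : HasSum (fun l : ℕ => s / 2 / 2 ^ l) s := hasSum_geometric_two' s
    have hgeom2 : HasSum (fun l : ℕ => 2 * (C / s * ε) / 2 / 2 ^ l * 2)
        (2 * (C / s * ε) * 2) := (hasSum_geometric_two' _).mul_right 2
    set T : ℕ → Set X := fun l => {x | ENNReal.ofReal (s / 2 / 2 ^ l) < hausdorffPre m δ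
        ((Subtype.val : A → EuclideanSpace ℝ (Fin (n + m))) '' (f ⁻¹' {x}) ∩ S l)} with hT
    have hTl : ∀ l, hausdorffPre n δ (T l) ≤ ENNReal.ofReal (2 * (C / s * ε) / 2 / 2 ^ l * 2) := by
      intro l
      obtain ⟨h1, h2, h3, h4⟩ := h l
      refine (hausdorffPre_large_fibers_le n m hf hL h1 (hsl l)
        (hrδ.trans' (by gcongr)) h3 (ne_top_of_le_ne_top ENNReal.ofReal_ne_top h4)).trans ?_
      refine ENNReal.ofReal_le_ofReal ?_
      have h5 : (volume (W l)).toReal ≤ ε * (1 / 4) ^ l :=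
        ENNReal.toReal_le_of_le_ofReal (by positivity) h4
      calc C * (volume (W l)).toReal / (s / 2 / 2 ^ l) ≤ C * (ε * (1 / 4) ^ l) / (s / 2 / 2 ^ l) := by
            gcongr
        _ = 2 * (C / s * ε) / 2 / 2 ^ l * 2 := by
            rw [show (4 : ℝ) = 2 * 2 by norm_num, div_pow, mul_pow, one_pow]
            field_simp
    calc _ ≤ hausdorffPre n δ (⋃ l, T l) := by
          refine measure_mono fun x hx => ?_
          by_contra hxT
          simp only [hT, Set.mem_iUnion, Set.mem_ofPred_eq, not_exists, not_lt] at hxT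
          refine (not_le.2 (Set.mem_ofPred_eq ▸ hx)) ?_
          calc hausdorffPre m δ ((Subtype.val : A → EuclideanSpace ℝ (Fin (n + m))) '' (f ⁻¹' {x}))
              ≤ hausdorffPre m δ (⋃ l,
                (Subtype.val : A → EuclideanSpace ℝ (Fin (n + m))) '' (f ⁻¹' {x}) ∩ S l) := by
                refine measure_mono ?_
                rw [← Set.inter_iUnion]
                exact Set.subset_inter subset_rfl
                  ((Subtype.coe_image_subset A _).trans hAS)
            _ ≤ ∑' l, ENNReal.ofReal (s / 2 / 2 ^ l) :=
                (measure_iUnion_le _).trans (ENNReal.tsum_le_tsum hxT)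
            _ = ENNReal.ofReal s := by
                rw [← ENNReal.ofReal_tsum_of_nonneg (fun l => (hsl l).le) hgeom.summable,
                  hgeom.tsum_eq]
      _ ≤ ∑' l, ENNReal.ofReal (2 * (C / s * ε) / 2 / 2 ^ l * 2) :=
          (measure_iUnion_le _).trans (ENNReal.tsum_le_tsum hTl)
      _ = ENNReal.ofReal (ε * (4 * C / s)) := by
          rw [← ENNReal.ofReal_tsum_of_nonneg (fun l => by positivity) hgeom2.summable,
            hgeom2.tsum_eq]
          congr 1
          ring
  refine nonpos_iff_eq_zero.1 (ge_of_tendsto (x := 𝓝[>] (0 : ℝ)) ?_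
    (eventually_nhdsWithin_of_forall key))
  have : Tendsto (fun ε : ℝ => ENNReal.ofReal (ε * (4 * C / s))) (𝓝 0)
      (𝓝 (ENNReal.ofReal (0 * (4 * C / s)))) :=
    (ENNReal.continuous_ofReal.comp (continuous_id.mul continuous_const)).tendsto 0
  simpa using this.mono_left nhdsWithin_le_nhds

/-- Almost every fibre of a Lipschitz map defined on a Lebesgue null subset of `ℝⁿ⁺ᵐ` is
`𝓗ᵐ`-null. -/
theorem ae_hausdorffMeasure_fiber_eq_zero (n m : ℕ) {X : Type*} [MetricSpace X]
    [MeasurableSpace X] [BorelSpace X] {A : Set (EuclideanSpace ℝ (Fin (n + m)))} {f : A → X}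
    {L : ℝ≥0} (hf : LipschitzWith L f) (hA : volume A = 0) :
    ∀ᵐ x ∂(Measure.hausdorffMeasure (n : ℝ) : Measure X), Measure.hausdorffMeasure (m : ℝ)
      ((Subtype.val : A → EuclideanSpace ℝ (Fin (n + m))) '' (f ⁻¹' {x})) = 0 := by
  have hf' : LipschitzWith (max L 1) f := hf.weaken (le_max_left _ _)
  have hB : ∀ j k : ℕ, Measure.hausdorffMeasure (n : ℝ)
      {x : X | ENNReal.ofReal (1 / (j + 1)) < hausdorffPre m (k : ℝ≥0∞)⁻¹
        ((Subtype.val : A → EuclideanSpace ℝ (Fin (n + m))) '' (f ⁻¹' {x}))} = 0 := by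
    intro j k
    rw [hausdorffMeasure_eq_zero_iff_hausdorffPre]
    intro i
    refine nonpos_iff_eq_zero.1 ?_
    -- The estimate uses one `δ` in both dimensions, so both sizes are refined to the smaller one.
    refine (hausdorffPre_anti n (ENNReal.inv_le_inv.2
      (Nat.cast_le.2 (le_max_left i k))) _).trans ?_
    refine (measure_mono ?_).trans (hausdorffPre_large_fibers_eq_zero n m hf' (le_max_right _ _) hA
      (s := 1 / (j + 1)) (by positivity) (δ := ((max i k : ℕ) : ℝ≥0∞)⁻¹) (by simp)).le
    exact fun x hx => hx.trans_le (hausdorffPre_anti m (ENNReal.inv_le_inv.2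
      (Nat.cast_le.2 (le_max_right i k))) _)
  have hall : ∀ᵐ x ∂(Measure.hausdorffMeasure (n : ℝ) : Measure X), ∀ j k : ℕ,
      hausdorffPre m (k : ℝ≥0∞)⁻¹
        ((Subtype.val : A → EuclideanSpace ℝ (Fin (n + m))) '' (f ⁻¹' {x}))
        ≤ ENNReal.ofReal (1 / (j + 1)) := by
    rw [ae_all_iff]
    intro j
    rw [ae_all_iff]
    intro k
    rw [ae_iff]
    simpa only [not_le] using hB j k
  filter_upwards [hall] with x hx
  rw [hausdorffMeasure_eq_zero_iff_hausdorffPre]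
  intro k
  refine nonpos_iff_eq_zero.1 (ge_of_tendsto' (x := atTop) ?_ fun j => hx j k)
  simpa [Function.comp_def] using (ENNReal.continuous_ofReal.tendsto 0).comp
    (tendsto_one_div_add_atTop_nhds_zero_nat (𝕜 := ℝ))

/-! ### Oscillation along directions of small derivative. -/

theorem LipschitzWith.abs_sub_le_of_abs_deriv_le {g : ℝ → ℝ} {K : ℝ≥0} (hg : LipschitzWith K g)
    {c θ : ℝ} (hc : 0 ≤ c) (hθ : 0 ≤ θ) {G : Set ℝ} (hG : MeasurableSet G)
    (hGc : ∀ s ∈ G, |deriv g s| ≤ c)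
    (hvol : volume {s : ℝ | s ∈ Set.Icc (0 : ℝ) 1 ∧ s ∉ G} ≤ ENNReal.ofReal θ) :
    |g 1 - g 0| ≤ c + K * θ := by
  have hac := (hg.lipschitzOnWith (s := Set.uIcc 0 1)).absolutelyContinuousOnInterval
  have hint := hac.integral_deriv_eq_sub
  rw [← hint, ← Real.norm_eq_abs]
  have hii : IntegrableOn (fun s => c + Gᶜ.indicator (fun _ => (K : ℝ)) s) (Set.Ioc 0 1) :=
    (integrable_const c).add ((integrable_const (K : ℝ)).indicator hG.compl)
  have hb : ∀ᵐ t, t ∈ Set.Ioc (0 : ℝ) 1 → ‖deriv g t‖ ≤ c + Gᶜ.indicator (fun _ => (K : ℝ)) t := by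
    refine Eventually.of_forall fun t _ => ?_
    by_cases ht : t ∈ G
    · simpa [ht] using hGc t ht
    · simpa [ht] using (norm_deriv_le_of_lipschitz hg).trans (le_add_of_nonneg_left hc)
  refine (intervalIntegral.norm_integral_le_of_norm_le zero_le_one hb
    ((intervalIntegrable_iff_integrableOn_Ioc_of_le zero_le_one).2 hii)).trans ?_
  rw [intervalIntegral.integral_of_le zero_le_one, integral_add (integrable_const c)
    ((integrable_const (K : ℝ)).indicator hG.compl), integral_indicator hG.compl]
  simp only [integral_const, measureReal_restrict_apply MeasurableSet.univ, Set.univ_inter,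
    Real.volume_real_Ioc_of_le zero_le_one, sub_zero, smul_eq_mul]
  rw [measureReal_restrict_apply hG.compl, one_mul, mul_comm]
  gcongr
  refine ENNReal.toReal_le_of_le_ofReal hθ ((measure_mono ?_).trans hvol)
  exact fun s hs => ⟨Set.Ioc_subset_Icc_self hs.2, hs.1⟩

/-- By Fubini: if every small translate of the segment met `Gᶜ` in length more than `θ`, integrating
over the translations would make `Gᶜ` too large near `x`. -/
theorem exists_translate_segment_mostly_mem {D : ℕ} {G : Set (EuclideanSpace ℝ (Fin D))}
    (hG : MeasurableSet G) {x z v : EuclideanSpace ℝ (Fin D)} {R t θ : ℝ}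
    (hR : dist z x + t + ‖v‖ ≤ R)
    (hvol : volume (Gᶜ ∩ Metric.closedBall x R) <
      volume (Metric.ball (0 : EuclideanSpace ℝ (Fin D)) t) * ENNReal.ofReal θ) :
    ∃ u : EuclideanSpace ℝ (Fin D), ‖u‖ ≤ t ∧
      volume {s : ℝ | s ∈ Set.Icc (0 : ℝ) 1 ∧ z + u + s • v ∉ G} ≤ ENNReal.ofReal θ := by
  by_contra! hcon
  refine hvol.not_ge ?_
  set B : Set (EuclideanSpace ℝ (Fin D)) := Gᶜ
  have hB : MeasurableSet B := hG.compl
  have hcont : Continuous fun q : EuclideanSpace ℝ (Fin D) × ℝ => z + q.1 + q.2 • v := by fun_prop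
  calc volume (Metric.ball (0 : EuclideanSpace ℝ (Fin D)) t) * ENNReal.ofReal θ
      = ∫⁻ u in Metric.ball (0 : EuclideanSpace ℝ (Fin D)) t, ENNReal.ofReal θ := by
        simp [mul_comm]
    _ ≤ ∫⁻ u in Metric.ball (0 : EuclideanSpace ℝ (Fin D)) t, ∫⁻ s in Set.Icc (0 : ℝ) 1,
          B.indicator 1 (z + u + s • v) := by
        refine setLIntegral_mono' Metric.isOpen_ball.measurableSet fun u hu => ?_
        refine (hcon u (by simpa using (Metric.mem_ball.1 hu).le)).le.trans (le_of_eq ?_)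
        have hmeas : MeasurableSet ((fun s : ℝ => z + u + s • v) ⁻¹' B) :=
          (by fun_prop : Continuous fun s : ℝ => z + u + s • v).measurable hB
        have : ∀ s : ℝ, B.indicator (1 : EuclideanSpace ℝ (Fin D) → ℝ≥0∞) (z + u + s • v)
            = ((fun s : ℝ => z + u + s • v) ⁻¹' B).indicator 1 s := fun s => rfl
        simp only [this]
        rw [lintegral_indicator_one hmeas, Measure.restrict_apply hmeas]
        congr 1
        ext s
        exact and_comm
    _ = ∫⁻ s in Set.Icc (0 : ℝ) 1, ∫⁻ u in Metric.ball (0 : EuclideanSpace ℝ (Fin D)) t,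
          B.indicator 1 (z + u + s • v) := by
        refine lintegral_lintegral_swap ?_
        exact ((measurable_one.indicator hB).comp hcont.measurable).aemeasurable
    _ ≤ ∫⁻ s in Set.Icc (0 : ℝ) 1, volume (B ∩ Metric.closedBall x R) := by
        refine setLIntegral_mono' measurableSet_Icc fun s hs => ?_
        have hmeas : MeasurableSet ((fun u => z + u + s • v) ⁻¹' B) :=
          (by fun_prop : Continuous fun u => z + u + s • v).measurable hB
        have : ∀ u, B.indicator (1 : EuclideanSpace ℝ (Fin D) → ℝ≥0∞) (z + u + s • v)
            = ((fun u => z + u + s • v) ⁻¹' B).indicator 1 u := fun u => rfl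
        simp only [this]
        rw [lintegral_indicator_one hmeas, Measure.restrict_apply hmeas,
          ← measure_preimage_add volume (z + s • v) (B ∩ Metric.closedBall x R)]
        refine measure_mono fun u hu => ?_
        have e : z + s • v + u = z + u + s • v := by abel
        refine ⟨by simpa [e] using hu.1, ?_⟩
        have h1 : ‖u‖ < t := by simpa using hu.2
        have h2 : ‖s • v‖ ≤ ‖v‖ := by
          rw [norm_smul, Real.norm_of_nonneg hs.1]
          exact mul_le_of_le_one_left (norm_nonneg v) hs.2
        change z + s • v + u ∈ Metric.closedBall x R
        rw [e, Metric.mem_closedBall, dist_eq_norm,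
          show z + u + s • v - x = (z - x) + u + s • v by abel]
        rw [dist_eq_norm] at hR
        linarith [norm_add₃_le (a := z - x) (b := u) (c := s • v)]
    _ = volume (B ∩ Metric.closedBall x R) := by simp

theorem ae_eventually_volume_compl_inter_lt {D : ℕ} {G : Set (EuclideanSpace ℝ (Fin D))}
    (hG : MeasurableSet G) {R t θ : ℝ} (hR : 0 < R) (ht : 0 < t) (hθ : 0 < θ) :
    ∀ᵐ x : EuclideanSpace ℝ (Fin D), x ∈ G → ∀ᶠ r in 𝓝[>] (0 : ℝ),
      volume (Gᶜ ∩ Metric.closedBall x (R * r)) <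
        volume (Metric.ball (0 : EuclideanSpace ℝ (Fin D)) (t * r)) * ENNReal.ofReal θ := by
  filter_upwards [Besicovitch.ae_tendsto_measure_inter_div_of_measurableSet volume hG.compl]
    with x hx hxG
  rw [Set.indicator_of_notMem (by simpa using hxG)] at hx
  have hlim : Tendsto (fun r : ℝ => R * r) (𝓝[>] 0) (𝓝[>] 0) := by
    refine tendsto_nhdsWithin_iff.2 ⟨?_, eventually_nhdsWithin_of_forall fun r hr =>
      mul_pos hR hr⟩
    have : Tendsto (fun r : ℝ => R * r) (𝓝 0) (𝓝 (R * 0)) := tendsto_id.const_mul R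
    rw [mul_zero] at this
    exact this.mono_left nhdsWithin_le_nhds
  have hev := (hx.comp hlim).eventually_lt_const
    (u := ENNReal.ofReal ((t / R) ^ D * θ)) (by simpa using by positivity)
  filter_upwards [hev, self_mem_nhdsWithin] with r hr hr0
  have hr0' : (0 : ℝ) < r := hr0
  simp only [Function.comp_apply] at hr
  have hpos : volume (Metric.closedBall x (R * r)) ≠ 0 :=
    (Metric.measure_closedBall_pos _ _ (by positivity)).ne'
  rw [ENNReal.div_lt_iff (Or.inl hpos) (Or.inl measure_closedBall_lt_top.ne)] at hr
  refine hr.trans_eq ?_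
  rw [Measure.addHaar_closedBall _ _ (by positivity),
    Measure.addHaar_ball_of_pos _ (0 : EuclideanSpace ℝ (Fin D)) (r := t * r) (by positivity),
    ← mul_assoc, ← ENNReal.ofReal_mul (by positivity),
    mul_right_comm (ENNReal.ofReal ((t * r) ^ _)),
    ← ENNReal.ofReal_mul (by positivity)]
  congr 2
  simp only [finrank_euclideanSpace, Fintype.card_fin, mul_pow, div_pow]
  field_simp

/-- The points at which all functions of the family `φ` are differentiable with derivatives that are
at most `c` in the directions `b i`, `p ≤ i`. -/
def smallDerivSet {D : ℕ} (φ : ℕ → EuclideanSpace ℝ (Fin D) → ℝ) (p : ℕ)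
    (b : Fin D → EuclideanSpace ℝ (Fin D)) (c : ℝ) : Set (EuclideanSpace ℝ (Fin D)) :=
  {x | ∀ j, DifferentiableAt ℝ (φ j) x ∧ ∀ i : Fin D, p ≤ i → |fderiv ℝ (φ j) x (b i)| ≤ c}

theorem measurableSet_smallDerivSet {D : ℕ} (φ : ℕ → EuclideanSpace ℝ (Fin D) → ℝ) (p : ℕ)
    (b : Fin D → EuclideanSpace ℝ (Fin D)) (c : ℝ) : MeasurableSet (smallDerivSet φ p b c) := by
  have : smallDerivSet φ p b c = ⋂ j, ({x | DifferentiableAt ℝ (φ j) x} ∩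
      ⋂ i : Fin D, ⋂ _ : p ≤ i, {x | |fderiv ℝ (φ j) x (b i)| ≤ c}) := by
    ext x
    simp [smallDerivSet]
  rw [this]
  refine MeasurableSet.iInter fun j => (measurableSet_of_differentiableAt ℝ (φ j)).inter
    (MeasurableSet.iInter fun i => MeasurableSet.iInter fun _ => ?_)
  exact measurableSet_le (measurable_fderiv_apply_const ℝ (φ j) (b i)).norm measurable_const

/-- The increment is estimated along `z`, `z + u`, `z + u + v`, `z + v`, `y`, where `u` is a short
shift making the segment good. The bound is the same for all `j` because the good set controls all
`φ j` at once. -/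
theorem abs_sub_le_of_inner_le {D : ℕ} {φ : ℕ → EuclideanSpace ℝ (Fin D) → ℝ} {L : ℝ≥0}
    (hφ : ∀ j, LipschitzWith L (φ j)) {p N : ℕ} (hN : 0 < N)
    (b : OrthonormalBasis (Fin D) ℝ (EuclideanSpace ℝ (Fin D)))
    {x y z : EuclideanSpace ℝ (Fin D)} {r : ℝ} (hr : 0 < r)
    (hvol : volume ((smallDerivSet φ p b (1 / N))ᶜ ∩ Metric.closedBall x ((2 + 2 * D) * r)) <
      volume (Metric.ball (0 : EuclideanSpace ℝ (Fin D)) (1 / N * r)) * ENNReal.ofReal (1 / N))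
    (hy : dist y x ≤ r) (hz : dist z x ≤ r)
    (hyz : ∀ i : Fin D, (i : ℕ) < p → |inner ℝ (b i) (y - z)| ≤ r / N) (j : ℕ) :
    |φ j y - φ j z| ≤ (3 * L * D + 2 * L + 2 * D) * (r / N) := by
  have hN1 : (1 : ℝ) ≤ N := by exact_mod_cast hN
  set a := y - z with ha
  have hanorm : ‖a‖ ≤ 2 * r := by
    rw [ha, ← dist_eq_norm]
    linarith [dist_triangle_right y z x]
  have hcoord : ∀ i, |inner ℝ (b i) a| ≤ 2 * r := fun i => by
    refine (abs_real_inner_le_norm _ _).trans ?_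
    rw [b.norm_eq_one, one_mul]
    exact hanorm
  -- `v` is the part of `y - z` along the directions of small derivative; the remainder `w` is short
  -- by `hyz`.
  set v := ∑ i : Fin D, if (i : ℕ) < p then 0 else inner ℝ (b i) a • b i with hv
  set w := ∑ i : Fin D, if (i : ℕ) < p then inner ℝ (b i) a • b i else 0 with hw
  have hvw : a = v + w := by
    rw [← b.sum_repr' a, hv, hw, ← Finset.sum_add_distrib]
    refine Finset.sum_congr rfl fun i _ => ?_
    split_ifs <;> simp
  have hvn : ‖v‖ ≤ D * (2 * r) := by
    refine (norm_sum_le_of_le _ (f := fun i : Fin D => if (i : ℕ) < p then 0 else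
      inner ℝ (b i) a • b i) (n := fun _ => 2 * r) fun i _ => ?_).trans (by simp)
    split_ifs
    · simpa using hr.le
    · rw [norm_smul, b.norm_eq_one, mul_one]
      exact hcoord i
  have hwn : ‖w‖ ≤ D * (r / N) := by
    refine (norm_sum_le_of_le _ (f := fun i : Fin D => if (i : ℕ) < p then
      inner ℝ (b i) a • b i else 0) (n := fun _ => r / N) fun i _ => ?_).trans (by simp)
    split_ifs with h
    · rw [norm_smul, b.norm_eq_one, mul_one]
      exact hyz i h
    · simpa using by positivity
  have htr : 1 / N * r ≤ r := by
    refine mul_le_of_le_one_left hr.le ?_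
    rw [div_le_one (by linarith)]
    exact hN1
  obtain ⟨u, hu, hvol'⟩ := exists_translate_segment_mostly_mem
    (measurableSet_smallDerivSet φ p b (1 / N)) (z := z) (v := v) (by nlinarith) hvol
  have hderiv : ∀ q ∈ smallDerivSet φ p b (1 / N), |fderiv ℝ (φ j) q v| ≤ 2 * D * (r / N) := by
    intro q hq
    rw [hv, map_sum]
    refine (Finset.abs_sum_le_sum_abs _ _).trans ?_
    refine (Finset.sum_le_card_nsmul _ _ (2 * (r / N)) fun i _ => ?_).trans (le_of_eq ?_)
    · split_ifs with h
      · simpa using by positivity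
      · rw [map_smul, smul_eq_mul, abs_mul]
        refine (mul_le_mul (hcoord i) ((hq j).2 i (not_lt.1 h)) (abs_nonneg _)
          (by positivity)).trans (le_of_eq (by ring))
    · simp
      ring
  set g : ℝ → ℝ := fun s => φ j (z + u + s • v) with hg
  have hgL : LipschitzWith (L * ‖v‖₊) g := by
    refine (hφ j).comp (LipschitzWith.of_dist_le_mul fun s t => ?_)
    rw [dist_add_left, dist_eq_norm, ← sub_smul, norm_smul, mul_comm, ← dist_eq_norm]
    rfl
  have hmeas : MeasurableSet {s : ℝ | z + u + s • v ∈ smallDerivSet φ p b (1 / N)} :=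
    (by fun_prop : Continuous fun s : ℝ => z + u + s • v).measurable
      (measurableSet_smallDerivSet φ p b (1 / N))
  have hpath := hgL.abs_sub_le_of_abs_deriv_le (c := 2 * D * (r / N)) (θ := 1 / N) (by positivity)
    (by positivity) hmeas (fun s hs => by
      have hd : HasDerivAt g (fderiv ℝ (φ j) (z + u + s • v) v) s := by
        have h1 : HasDerivAt (fun s : ℝ => z + u + s • v) v s := by
          simpa using ((hasDerivAt_id s).smul_const v).const_add (z + u)
        exact (hs j).1.hasFDerivAt.comp_hasDerivAt s h1
      rw [hd.deriv]
      exact hderiv _ hs) hvol'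
  have e1 : |φ j y - φ j (z + v)| ≤ L * (D * (r / N)) := by
    refine ((hφ j).dist_le_mul y (z + v)).trans ?_
    rw [dist_eq_norm, show y - (z + v) = w by rw [← sub_sub, ← ha, hvw]; abel]
    gcongr
  have e2 : |φ j (z + v) - g 1| ≤ L * (1 / N * r) := by
    refine ((hφ j).dist_le_mul (z + v) (z + u + (1 : ℝ) • v)).trans ?_
    rw [dist_eq_norm, show z + v - (z + u + (1 : ℝ) • v) = -u by rw [one_smul]; abel, norm_neg]
    gcongr
  have e3 : |g 0 - φ j z| ≤ L * (1 / N * r) := by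
    refine ((hφ j).dist_le_mul (z + u + (0 : ℝ) • v) z).trans ?_
    rw [dist_eq_norm, show z + u + (0 : ℝ) • v - z = u by rw [zero_smul]; abel]
    gcongr
  have e4 : ((L * ‖v‖₊ : ℝ≥0) : ℝ) * (1 / N) ≤ L * (D * (2 * r)) * (1 / N) := by
    push_cast
    gcongr
  calc |φ j y - φ j z| = |(φ j y - φ j (z + v)) + (φ j (z + v) - g 1) + (g 1 - g 0)
        + (g 0 - φ j z)| := by congr 1; ring
    _ ≤ |φ j y - φ j (z + v)| + |φ j (z + v) - g 1| + |g 1 - g 0| + |g 0 - φ j z| :=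
        (abs_add_le _ _).trans (add_le_add_left ((abs_add_le _ _).trans
          (add_le_add_left (abs_add_le _ _) _)) _)
    _ ≤ L * (D * (r / N)) + L * (1 / N * r) + (2 * D * (r / N) + L * (D * (2 * r)) * (1 / N))
        + L * (1 / N * r) := by linarith
    _ = (3 * L * D + 2 * L + 2 * D) * (r / N) := by ring

/-! ### Vanishing density where the rank is too small. -/

theorem hausdorffContent_le_sum {X : Type*} [MetricSpace X] {n : ℕ} {E : Set X} {ι : Type*}
    [Fintype ι] (t : ι → Set X) (hE : E ⊆ ⋃ i, t i) :
    hausdorffContent n E ≤ unitBallVolume n / 2 ^ n * ∑ i, Metric.ediam (t i) ^ n := by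
  classical
  cases nonempty_encodable ι
  rename_i hι
  refine (iInf₂_le (fun k : ℕ => ⋃ i ∈ Encodable.decode₂ ι k, t i) ?_).trans ?_
  · rwa [Encodable.iUnion_decode₂]
  · gcongr
    rw [tsum_iUnion_decode₂ (fun s : Set X => ⨆ _ : s.Nonempty, Metric.ediam s ^ n) (by simp) t,
      tsum_fintype]
    exact Finset.sum_le_sum fun i _ => iSup_le fun _ => le_rfl

theorem hausdorffContent_image_ball_le {D p N : ℕ} (hN : 0 < N) {X : Type*} [MetricSpace X]
    {A : Set (EuclideanSpace ℝ (Fin D))} (f : A → X)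
    (b : OrthonormalBasis (Fin D) ℝ (EuclideanSpace ℝ (Fin D))) (hp : p ≤ D)
    (x : EuclideanSpace ℝ (Fin D)) {r d : ℝ} (hr : 0 < r)
    (hf : ∀ y z : A, dist (y : EuclideanSpace ℝ (Fin D)) x ≤ r →
      dist (z : EuclideanSpace ℝ (Fin D)) x ≤ r → (∀ i : Fin D, (i : ℕ) < p →
        |inner ℝ (b i) ((y : EuclideanSpace ℝ (Fin D)) - z)| ≤ r / N) → dist (f y) (f z) ≤ d) :
    hausdorffContent (p + 1) (f '' {y : A | (y : EuclideanSpace ℝ (Fin D)) ∈ Metric.ball x r}) ≤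
      unitBallVolume (p + 1) / 2 ^ (p + 1) * ((2 * N) ^ p * ENNReal.ofReal d ^ (p + 1)) := by
  have hN0 : (0 : ℝ) < N := by exact_mod_cast hN
  -- Slabs of width `r / N` in the first `p` coordinates only; over a ball of radius `r` each index
  -- takes `2 * N` values.
  set cell : A → Fin p → ℤ := fun y i =>
    ⌊inner ℝ (b (Fin.castLE hp i)) ((y : EuclideanSpace ℝ (Fin D)) - x) * (N / r)⌋ with hcell
  set I : Type := Fin p → Finset.Ico (-(N : ℤ)) N
  set t : I → Set X := fun c => f '' {y : A | (y : EuclideanSpace ℝ (Fin D)) ∈ Metric.ball x r ∧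
    ∀ i, cell y i = c i} with ht
  have hcov : f '' {y : A | (y : EuclideanSpace ℝ (Fin D)) ∈ Metric.ball x r} ⊆ ⋃ c, t c := by
    rintro _ ⟨y, hy, rfl⟩
    have hmem : ∀ i, cell y i ∈ Finset.Ico (-(N : ℤ)) N := by
      intro i
      have h1 : |inner ℝ (b (Fin.castLE hp i)) ((y : EuclideanSpace ℝ (Fin D)) - x)| < r := by
        refine (abs_real_inner_le_norm _ _).trans_lt ?_
        rw [b.norm_eq_one, one_mul, ← dist_eq_norm]
        exact hy
      have h2 : |inner ℝ (b (Fin.castLE hp i)) ((y : EuclideanSpace ℝ (Fin D)) - x) * (N / r)|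
          < N := by
        rw [abs_mul, abs_of_pos (div_pos hN0 hr)]
        calc _ < r * (N / r) := by gcongr
          _ = N := by field_simp
      rw [abs_lt] at h2
      rw [Finset.mem_Ico, Int.le_floor, Int.floor_lt]
      push_cast
      exact ⟨h2.1.le, h2.2⟩
    exact Set.mem_iUnion.2 ⟨fun i => ⟨cell y i, hmem i⟩, y, ⟨hy, fun i => rfl⟩, rfl⟩
  refine (hausdorffContent_le_sum t hcov).trans ?_
  gcongr
  have hdiam : ∀ c, Metric.ediam (t c) ≤ ENNReal.ofReal d := by
    intro c
    refine Metric.ediam_le ?_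
    rintro _ ⟨y, ⟨hy, hyc⟩, rfl⟩ _ ⟨z, ⟨hz, hzc⟩, rfl⟩
    rw [edist_dist]
    refine ENNReal.ofReal_le_ofReal (hf y z (Metric.mem_ball.1 hy).le (Metric.mem_ball.1 hz).le ?_)
    intro i hi
    have h1 := Int.abs_sub_lt_one_of_floor_eq_floor ((hyc ⟨i, hi⟩).trans (hzc ⟨i, hi⟩).symm)
    rw [← sub_mul, ← inner_sub_right, sub_sub_sub_cancel_right, abs_mul,
      abs_of_pos (div_pos hN0 hr), ← lt_div_iff₀ (div_pos hN0 hr), one_div_div] at h1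
    exact h1.le
  calc ∑ c, Metric.ediam (t c) ^ (p + 1) ≤ ∑ _c : I, ENNReal.ofReal d ^ (p + 1) :=
        Finset.sum_le_sum fun c _ => by gcongr; exact hdiam c
    _ = (2 * N) ^ p * ENNReal.ofReal d ^ (p + 1) := by
        rw [Finset.sum_const, Finset.card_univ, nsmul_eq_mul]
        congr 1
        simp only [I, Fintype.card_pi, Fintype.card_coe, Int.card_Ico, Finset.prod_const,
          Finset.card_univ, Fintype.card_fin]
        rw [show ((N : ℤ) - -N).toNat = 2 * N by lia]
        push_cast
        rfl

theorem upperDensity_le_of_eventually {D p N : ℕ} (hN : 0 < N) {X : Type*} [MetricSpace X]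
    {A : Set (EuclideanSpace ℝ (Fin D))} {f : A → X} {x : A} {C : ℝ} (hC : 0 ≤ C)
    (h : ∀ᶠ r in 𝓝[>] (0 : ℝ), hausdorffContent (p + 1) (f '' {y : A |
        (y : EuclideanSpace ℝ (Fin D)) ∈ Metric.ball (x : EuclideanSpace ℝ (Fin D)) r}) ≤
      unitBallVolume (p + 1) / 2 ^ (p + 1) *
        ((2 * N) ^ p * ENNReal.ofReal (C * (r / N)) ^ (p + 1))) :
    upperDensity (p + 1) f x ≤ ENNReal.ofReal (C ^ (p + 1) / N) := by
  have hN0 : (0 : ℝ) < N := by exact_mod_cast hN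
  refine limsup_le_of_le (h := ?_)
  filter_upwards [h, self_mem_nhdsWithin] with r hr hr0
  have hr0' : (0 : ℝ) < r := hr0
  refine ENNReal.div_le_of_le_mul (hr.trans ?_)
  have hω := unitBallVolume_toReal_pos (p + 1)
  rw [← ENNReal.ofReal_toReal (unitBallVolume_ne_top (p + 1)), ← ENNReal.ofReal_pow hr0'.le,
    ← ENNReal.ofReal_mul hω.le, ← ENNReal.ofReal_mul (by positivity),
    ← ENNReal.ofReal_pow (by positivity),
    show (2 * (N : ℝ≥0∞)) ^ p = ENNReal.ofReal ((2 * N) ^ p) by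
      rw [ENNReal.ofReal_pow (by positivity), ENNReal.ofReal_mul (by norm_num)]; simp,
    show (2 : ℝ≥0∞) ^ (p + 1) = ENNReal.ofReal (2 ^ (p + 1)) by
      rw [ENNReal.ofReal_pow (by positivity)]; simp,
    ← ENNReal.ofReal_div_of_pos (by positivity), ← ENNReal.ofReal_mul (by positivity),
    ← ENNReal.ofReal_mul (by positivity)]
  refine ENNReal.ofReal_le_ofReal ?_
  set ω := (unitBallVolume (p + 1)).toReal
  calc ω / 2 ^ (p + 1) * ((2 * N) ^ p * (C * (r / N)) ^ (p + 1))
      = (1 / 2) * (C ^ (p + 1) / N * (ω * r ^ (p + 1))) := by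
        simp only [mul_pow, div_pow, pow_succ]
        field_simp
    _ ≤ C ^ (p + 1) / N * (ω * r ^ (p + 1)) := by
        have : 0 ≤ C ^ (p + 1) / N * (ω * r ^ (p + 1)) := by positivity
        linarith

theorem exists_orthonormalBasis_mem_of_le_finrank {D p : ℕ}
    (K : Submodule ℝ (EuclideanSpace ℝ (Fin D))) (hK : D ≤ Module.finrank ℝ K + p) :
    ∃ b : OrthonormalBasis (Fin D) ℝ (EuclideanSpace ℝ (Fin D)), ∀ i : Fin D, p ≤ i → b i ∈ K := by
  set s : Set (Fin D) := {i | p ≤ i}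
  set e := stdOrthonormalBasis ℝ K
  have hlt : ∀ i : s, (i : ℕ) - p < Module.finrank ℝ K := fun i => by
    have := i.1.2
    have h2 : p ≤ (i : ℕ) := i.2
    omega
  set g : s → Fin (Module.finrank ℝ K) := fun i => ⟨(i : ℕ) - p, hlt i⟩
  have hg : Function.Injective g := by
    intro i j hij
    have h := congrArg Fin.val hij
    have h1 : p ≤ (i : ℕ) := i.2
    have h2 : p ≤ (j : ℕ) := j.2
    simp only [g] at h
    exact Subtype.ext (Fin.ext (by lia))
  classical
  set v : Fin D → EuclideanSpace ℝ (Fin D) := fun i => if h : i ∈ s then e (g ⟨i, h⟩) else 0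
  have hv : s.domRestrict v = fun i => (e (g i) : EuclideanSpace ℝ (Fin D)) := by
    funext i
    simp [v]
  have horth : Orthonormal ℝ (s.domRestrict v) := by
    rw [hv]
    exact (e.orthonormal.comp_linearIsometry K.subtypeₗᵢ).comp g hg
  obtain ⟨b, hb⟩ := horth.exists_orthonormalBasis_extension_of_card_eq (by simp)
  refine ⟨b, fun i hi => ?_⟩
  have hi' : i ∈ s := hi
  rw [hb i hi']
  simp [v, hi']

/-- Almost everywhere on `A`, the upper density of `f` vanishes if the derivatives of the coordinate
functions `φ j` of `f` have a common kernel of codimension smaller than `p + 1`. -/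
theorem ae_upperDensity_eq_zero {D p : ℕ} (hp : p ≤ D) {X : Type*} [MetricSpace X]
    {A : Set (EuclideanSpace ℝ (Fin D))} {f : A → X} {φ : ℕ → EuclideanSpace ℝ (Fin D) → ℝ}
    {L : ℝ≥0} (hφ : ∀ j, LipschitzWith L (φ j))
    (hfφ : ∀ (y z : A) (c : ℝ), (∀ j, |φ j y - φ j z| ≤ c) → dist (f y) (f z) ≤ c) :
    ∀ᵐ x : EuclideanSpace ℝ (Fin D), ∀ hx : x ∈ A, (∀ j, DifferentiableAt ℝ (φ j) x) →
      ∀ K : Submodule ℝ (EuclideanSpace ℝ (Fin D)), D ≤ Module.finrank ℝ K + p →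
        (∀ j, ∀ v ∈ K, fderiv ℝ (φ j) x v = 0) → upperDensity (p + 1) f ⟨x, hx⟩ = 0 := by
  -- The kernel varies with `x`, while density points can be taken a.e. only for countably many
  -- sets; hence a countable dense family of orthonormal frames.
  obtain ⟨B, hBc, hBd⟩ := TopologicalSpace.exists_countable_dense
    {b : Fin D → EuclideanSpace ℝ (Fin D) // Orthonormal ℝ b}
  have hae : ∀ᵐ x : EuclideanSpace ℝ (Fin D), ∀ b ∈ B, ∀ N : ℕ,
      x ∈ smallDerivSet φ p b.1 (1 / (N + 1 : ℕ)) → ∀ᶠ r in 𝓝[>] (0 : ℝ),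
        volume ((smallDerivSet φ p b.1 (1 / (N + 1 : ℕ)))ᶜ ∩
          Metric.closedBall x ((2 + 2 * D) * r)) <
        volume (Metric.ball (0 : EuclideanSpace ℝ (Fin D)) (1 / (N + 1 : ℕ) * r)) *
          ENNReal.ofReal (1 / (N + 1 : ℕ)) := by
    rw [ae_ball_iff hBc]
    intro b hb
    rw [ae_all_iff]
    intro N
    exact ae_eventually_volume_compl_inter_lt (measurableSet_smallDerivSet φ p b.1 _)
      (by positivity) (by positivity) (by positivity)
  filter_upwards [hae] with x hx hxA hdiff K hK hker
  set C : ℝ := 3 * L * D + 2 * L + 2 * D with hC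
  have hbound : ∀ N : ℕ, upperDensity (p + 1) f ⟨x, hxA⟩
      ≤ ENNReal.ofReal (C ^ (p + 1) / (N + 1 : ℕ)) := by
    intro N
    have hN0 : (0 : ℝ) < (N + 1 : ℕ) := by positivity
    obtain ⟨b₀, hb₀⟩ := exists_orthonormalBasis_mem_of_le_finrank K hK
    -- Derivatives vanish on `b₀ i` for `p ≤ i` and have norm at most `L`, so this tolerance keeps
    -- them below `1 / (N + 1)` on `b`.
    obtain ⟨b, hbB, hb⟩ := Metric.dense_iff.1 hBd ⟨b₀, b₀.orthonormal⟩
      (1 / ((L + 1) * (N + 1 : ℕ))) (by positivity)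
    have hxb : x ∈ smallDerivSet φ p b.1 (1 / (N + 1 : ℕ)) := by
      intro j
      refine ⟨hdiff j, fun i hi => ?_⟩
      have h1 : fderiv ℝ (φ j) x (b.1 i) = fderiv ℝ (φ j) x (b.1 i - b₀ i) := by
        rw [map_sub, hker j _ (hb₀ i hi), sub_zero]
      have h2 : ‖b.1 i - b₀ i‖ ≤ 1 / ((L + 1) * (N + 1 : ℕ)) := by
        rw [← dist_eq_norm]
        exact (dist_le_pi_dist b.1 b₀ i).trans (Metric.mem_ball.1 hbB).le
      rw [h1, ← Real.norm_eq_abs]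
      calc _ ≤ ‖fderiv ℝ (φ j) x‖ * ‖b.1 i - b₀ i‖ := ContinuousLinearMap.le_opNorm _ _
        _ ≤ (L + 1) * (1 / ((L + 1) * (N + 1 : ℕ))) := by
          gcongr
          exact (norm_fderiv_le_of_lipschitz ℝ (hφ j)).trans (by linarith)
        _ = 1 / (N + 1 : ℕ) := by field_simp
    have hspan : ⊤ ≤ Submodule.span ℝ (Set.range b.1) :=
      (b.2.linearIndependent.span_eq_top_of_card_eq_finrank' (by simp)).ge
    set b' := OrthonormalBasis.mk b.2 hspan with hb'
    have hbb' : (b' : Fin D → EuclideanSpace ℝ (Fin D)) = b.1 := OrthonormalBasis.coe_mk _ _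
    refine upperDensity_le_of_eventually (Nat.succ_pos N) (by positivity) ?_
    filter_upwards [hx b hb N hxb, self_mem_nhdsWithin] with r hr hr0
    rw [← hbb'] at hr
    refine hausdorffContent_image_ball_le (Nat.succ_pos N) f b' hp x hr0 fun y z hy hz hyz => ?_
    exact hfφ y z _ fun j => abs_sub_le_of_inner_le hφ (Nat.succ_pos N) b' hr0 hr hy hz hyz j
  refine nonpos_iff_eq_zero.1 (ge_of_tendsto' (x := atTop) ?_ hbound)
  have h1 : Tendsto (fun N : ℕ => C ^ (p + 1) / ((N + 1 : ℕ) : ℝ)) atTop (𝓝 0) :=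
    (tendsto_const_div_atTop_nhds_zero_nat (C ^ (p + 1))).comp (tendsto_add_atTop_nat 1)
  simpa [Function.comp_def] using (ENNReal.continuous_ofReal.tendsto 0).comp h1

/-! ### Coordinates, kernels and rectifiable pieces. -/

/-- A Lipschitz map into a metric space has countably many globally defined Lipschitz coordinate
functions which determine the distances between its values. -/
theorem exists_lipschitz_coordinates {D : ℕ} {X : Type*} [MetricSpace X]
    {A : Set (EuclideanSpace ℝ (Fin D))} {f : A → X} {L : ℝ≥0} (hf : LipschitzWith L f) :
    ∃ φ : ℕ → EuclideanSpace ℝ (Fin D) → ℝ, (∀ j, LipschitzWith L (φ j)) ∧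
      (∀ (y z : A) (c : ℝ), (∀ j, |φ j y - φ j z| ≤ c) → dist (f y) (f z) ≤ c) ∧
      ∀ y z : A, f y = f z → ∀ j, φ j y = φ j z := by
  rcases isEmpty_or_nonempty A with hA | hA
  · exact ⟨fun _ _ => 0, fun _ => LipschitzWith.const' 0, fun y => hA.elim y, fun y => hA.elim y⟩
  set d := TopologicalSpace.denseSeq A
  have hex : ∀ j, ∃ g : EuclideanSpace ℝ (Fin D) → ℝ, LipschitzWith L g ∧
      ∀ y : A, g y = dist (f y) (f (d j)) := by
    intro j
    set h : EuclideanSpace ℝ (Fin D) → ℝ :=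
      Function.extend (Subtype.val : A → _) (fun y => dist (f y) (f (d j))) 0
    have hh : ∀ y : A, h y = dist (f y) (f (d j)) := fun y =>
      Subtype.val_injective.extend_apply _ _ y
    have hL : LipschitzOnWith L h A := by
      refine LipschitzOnWith.of_dist_le_mul fun y hy z hz => ?_
      rw [hh ⟨y, hy⟩, hh ⟨z, hz⟩, Real.dist_eq]
      exact (abs_dist_sub_le _ _ _).trans (hf.dist_le_mul ⟨y, hy⟩ ⟨z, hz⟩)
    obtain ⟨g, hg, hgh⟩ := hL.extend_real
    exact ⟨g, hg, fun y => by rw [← hgh y.2, hh]⟩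
  choose φ hφ hφd using hex
  refine ⟨φ, hφ, fun y z c hc => ?_, fun y z hyz j => by rw [hφd, hφd, hyz]⟩
  refine le_of_forall_pos_le_add fun ε hε => ?_
  obtain ⟨j, hj⟩ := (TopologicalSpace.denseRange_denseSeq A).exists_dist_lt y
    (ε := ε / (2 * (L + 1))) (by positivity)
  have h1 : dist (f y) (f (d j)) ≤ ε / 2 := by
    refine (hf.dist_le_mul y (d j)).trans ?_
    calc L * dist y (d j) ≤ (L + 1) * (ε / (2 * (L + 1))) := by gcongr; linarith
      _ = ε / 2 := by field_simp
  have h2 := hc j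
  rw [hφd, hφd, abs_le] at h2
  linarith [dist_triangle_right (f y) (f z) (f (d j))]

/-- The kernels of the first `k` functionals decrease and stabilise by finite dimension; the stable
one is the common kernel. -/
theorem exists_finrank_ker_le_or_common_ker {E : Type*} [NormedAddCommGroup E] [NormedSpace ℝ E]
    [FiniteDimensional ℝ E] (ℓ : ℕ → E →L[ℝ] ℝ) (m : ℕ) :
    (∃ k, Module.finrank ℝ (LinearMap.ker
      (ContinuousLinearMap.pi fun j : Fin k => ℓ j).toLinearMap) ≤ m) ∨
      ∃ K : Submodule ℝ E, m < Module.finrank ℝ K ∧ ∀ j, ∀ v ∈ K, ℓ j v = 0 := by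
  by_contra! hcon
  obtain ⟨h1, h2⟩ := hcon
  set κ : ℕ → Submodule ℝ E := fun k =>
    LinearMap.ker (ContinuousLinearMap.pi fun j : Fin k => ℓ j).toLinearMap with hκ
  have hmem : ∀ k v, v ∈ κ k ↔ ∀ j < k, ℓ j v = 0 := by
    intro k v
    simp only [hκ, LinearMap.mem_ker, ContinuousLinearMap.coe_coe, funext_iff]
    exact ⟨fun h j hj => h ⟨j, hj⟩, fun h j => h j j.2⟩
  have hanti : Antitone κ := fun k l hkl v hv =>
    (hmem k v).2 fun j hj => (hmem l v).1 hv j (hj.trans_le hkl)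
  obtain ⟨k, hk⟩ := IsArtinian.monotone_stabilizes (R := ℝ) (M := E)
    ⟨fun k => OrderDual.toDual (κ k), fun k l hkl => hanti hkl⟩
  obtain ⟨j, v, hv, hne⟩ := h2 (κ k) (h1 k)
  refine hne ((hmem (max k (j + 1)) v).1 ?_ j (by lia))
  have := hk (max k (j + 1)) (le_max_left _ _)
  have e : κ k = κ (max k (j + 1)) := this
  rwa [← e]

/-- Extend an injection of the kernel into `ℝᵐ` to a linear `P`. Then `(T, P)` is injective, so
bounded below, and on vectors almost killed by `T` the bound must come from `P`. -/
theorem ContinuousLinearMap.exists_norm_le_of_finrank_ker_le {D m : ℕ} {F : Type*}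
    [NormedAddCommGroup F] [NormedSpace ℝ F] (T : EuclideanSpace ℝ (Fin D) →L[ℝ] F)
    (hT : Module.finrank ℝ (LinearMap.ker T.toLinearMap) ≤ m) :
    ∃ c : ℝ≥0, c ≠ 0 ∧ ∃ (P : EuclideanSpace ℝ (Fin D) →ₗ[ℝ] EuclideanSpace ℝ (Fin m)) (K : ℝ≥0),
      ∀ w, ‖T w‖ ≤ c * ‖w‖ → ‖w‖ ≤ K * ‖P w‖ := by
  obtain ⟨g, hg⟩ := (finrank_le_iff_exists_linearMap (R := ℝ)
    (M := LinearMap.ker T.toLinearMap) (M' := EuclideanSpace ℝ (Fin m))).1 (by simpa using hT)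
  obtain ⟨P, hP⟩ := LinearMap.exists_extend g
  have hker : LinearMap.ker (T.toLinearMap.prod P) = ⊥ := by
    rw [LinearMap.ker_eq_bot']
    intro w hw
    have h1 : T.toLinearMap w = 0 := congrArg Prod.fst hw
    have h2 : P w = 0 := congrArg Prod.snd hw
    have h3 : g ⟨w, h1⟩ = 0 := by rw [← hP]; exact h2
    exact congrArg Subtype.val (hg (h3.trans (map_zero g).symm))
  obtain ⟨K, hK, hKa⟩ := LinearMap.exists_antilipschitzWith _ hker
  refine ⟨1 / (2 * K), by positivity, P, K, fun w hw => ?_⟩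
  have h : ‖w‖ ≤ K * max ‖T w‖ ‖P w‖ := by
    have h := hKa.le_mul_dist w 0
    rwa [map_zero, dist_zero_right, dist_zero_right] at h
  have hK' : (0 : ℝ) < K := hK
  rcases le_total ‖P w‖ ‖T w‖ with hle | hle
  · rw [max_eq_left hle] at h
    have h4 : ‖w‖ ≤ K * ((1 / (2 * K)) * ‖w‖) := h.trans (by
      gcongr
      simpa using hw)
    have h5 : (K : ℝ) * ((1 / (2 * K)) * ‖w‖) = ‖w‖ / 2 := by field_simp
    have h6 : ‖w‖ ≤ 0 := by linarith
    exact h6.trans (by positivity)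
  · rwa [max_eq_right hle] at h

theorem exists_lipschitzOnWith_subset_image {D m : ℕ} {Z : Set (EuclideanSpace ℝ (Fin D))}
    (P : EuclideanSpace ℝ (Fin D) →ₗ[ℝ] EuclideanSpace ℝ (Fin m)) (K : ℝ≥0)
    (hZ : ∀ y ∈ Z, ∀ z ∈ Z, ‖y - z‖ ≤ K * ‖P (y - z)‖) :
    ∃ (S : Set (EuclideanSpace ℝ (Fin m)))
      (g : EuclideanSpace ℝ (Fin m) → EuclideanSpace ℝ (Fin D)),
      (∃ K : ℝ≥0, LipschitzOnWith K g S) ∧ Z ⊆ g '' S := by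
  have hinj : Set.InjOn P Z := by
    intro y hy z hz hyz
    have := hZ y hy z hz
    rw [map_sub, hyz, sub_self, norm_zero, mul_zero] at this
    exact sub_eq_zero.1 (norm_le_zero_iff.1 this)
  refine ⟨P '' Z, Function.invFunOn P Z, ⟨K, LipschitzOnWith.of_dist_le_mul ?_⟩, ?_⟩
  · rintro _ ⟨y, hy, rfl⟩ _ ⟨z, hz, rfl⟩
    rw [hinj.leftInvOn_invFunOn hy, hinj.leftInvOn_invFunOn hz, dist_eq_norm, dist_eq_norm,
      ← map_sub]
    exact hZ y hy z hz
  · exact fun y hy => ⟨P y, ⟨y, hy, rfl⟩, hinj.leftInvOn_invFunOn hy⟩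

/-- Up to a null set, the domain of a map with positive upper density decomposes into countably many
pieces in which all fibres are Lipschitz images of subsets of `ℝᵐ`. -/
theorem exists_decomposition_of_upperDensity_pos (n m : ℕ) {X : Type*} [MetricSpace X]
    {A : Set (EuclideanSpace ℝ (Fin (n + m)))} {f : A → X} {L : ℝ≥0} (hf : LipschitzWith L f)
    (hΘ : ∀ᵐ z ∂(volume : Measure (EuclideanSpace ℝ (Fin (n + m)))),
      ∀ hz : z ∈ A, 0 < upperDensity n f ⟨z, hz⟩) :
    ∃ Z : ℕ → ℕ → Set (EuclideanSpace ℝ (Fin (n + m))), volume (A \ ⋃ (k) (i), Z k i) = 0 ∧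
      ∀ k i x, ∃ (S : Set (EuclideanSpace ℝ (Fin m)))
        (g : EuclideanSpace ℝ (Fin m) → EuclideanSpace ℝ (Fin (n + m))),
        (∃ K : ℝ≥0, LipschitzOnWith K g S) ∧
        (Subtype.val : A → EuclideanSpace ℝ (Fin (n + m))) '' (f ⁻¹' {x}) ∩ Z k i ⊆ g '' S := by
  classical
  obtain ⟨φ, hφ, hfφ, hφf⟩ := exists_lipschitz_coordinates hf
  set F : ∀ k : ℕ, EuclideanSpace ℝ (Fin (n + m)) → Fin k → ℝ := fun k y j => φ j y with hF
  set F' : ∀ k : ℕ, EuclideanSpace ℝ (Fin (n + m)) →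
      EuclideanSpace ℝ (Fin (n + m)) →L[ℝ] (Fin k → ℝ) :=
    fun k y => ContinuousLinearMap.pi fun j : Fin k => fderiv ℝ (φ j) y with hF'
  set G : ℕ → Set (EuclideanSpace ℝ (Fin (n + m))) := fun k => {z | z ∈ A ∧
    (∀ j, DifferentiableAt ℝ (φ j) z) ∧
    Module.finrank ℝ (LinearMap.ker (F' k z).toLinearMap) ≤ m} with hG
  have hcover : ∀ᵐ z ∂(volume : Measure (EuclideanSpace ℝ (Fin (n + m)))),
      z ∈ A → ∃ k, z ∈ G k := by
    have hdiff : ∀ᵐ z ∂(volume : Measure (EuclideanSpace ℝ (Fin (n + m)))),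
        ∀ j, DifferentiableAt ℝ (φ j) z := ae_all_iff.2 fun j => (hφ j).ae_differentiableAt
    rcases n with _ | p
    · filter_upwards [hdiff] with z hz hzA
      -- For `n = 0` no coordinate is needed: the whole space has dimension `m`.
      refine ⟨0, hzA, hz, (Submodule.finrank_le _).trans (by simp)⟩
    · filter_upwards [hdiff, hΘ, ae_upperDensity_eq_zero (p := p) (by lia) hφ hfφ]
        with z hz hpos h0 hzA
      rcases exists_finrank_ker_le_or_common_ker (fun j => fderiv ℝ (φ j) z) m with
        ⟨k, hk⟩ | ⟨K, hK, hKj⟩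
      · exact ⟨k, hzA, hz, hk⟩
      · exact absurd (h0 hzA hz K (by omega) hKj) (hpos hzA).ne'
  set c : ∀ k : ℕ, (EuclideanSpace ℝ (Fin (n + m)) →L[ℝ] (Fin k → ℝ)) → ℝ≥0 := fun k T =>
    if hT : Module.finrank ℝ (LinearMap.ker T.toLinearMap) ≤ m then
      (T.exists_norm_le_of_finrank_ker_le hT).choose else 1 with hc
  have hc0 : ∀ k T, c k T ≠ 0 := by
    intro k T
    simp only [hc]
    split_ifs with hT
    · exact (T.exists_norm_le_of_finrank_ker_le hT).choose_spec.1
    · exact one_ne_zero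
  have hFd : ∀ k, ∀ z ∈ G k, HasFDerivAt (F k) (F' k z) z := fun k z hz =>
    hasFDerivAt_pi.2 fun j : Fin k => (hz.2.1 j).hasFDerivAt
  have hpart := fun k => exists_partition_approximatesLinearOn_of_hasFDerivWithinAt (F k) (G k)
    (F' k) (fun z hz => (hFd k z hz).hasFDerivWithinAt) (c k) (hc0 k)
  choose t T _ _ htG happrox hTmem using hpart
  refine ⟨fun k i => G k ∩ t k i, ?_, fun k i x => ?_⟩
  · refine measure_mono_null ?_ (ae_iff.1 hcover)
    rintro z ⟨hzA, hz⟩ hcon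
    obtain ⟨k, hk⟩ := hcon hzA
    obtain ⟨i, hi⟩ := Set.mem_iUnion.1 (htG k hk)
    exact hz (Set.mem_iUnion₂.2 ⟨k, i, hk, hi⟩)
  · rcases (G k).eq_empty_or_nonempty with hGe | hGne
    · exact ⟨∅, fun _ => 0, ⟨0, by simp⟩, by simp [hGe]⟩
    -- The approximating map is a derivative at a point of `G k`, so it inherits the kernel bound.
    obtain ⟨q, hq, hTq⟩ := hTmem k hGne i
    have hker : Module.finrank ℝ (LinearMap.ker (T k i).toLinearMap) ≤ m := by
      rw [hTq]; exact hq.2.2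
    obtain ⟨-, P, K, hPK⟩ := ((T k i).exists_norm_le_of_finrank_ker_le hker).choose_spec
    refine exists_lipschitzOnWith_subset_image P K ?_
    rintro _ ⟨⟨y, hy, rfl⟩, hyZ⟩ _ ⟨⟨z, hz, rfl⟩, hzZ⟩
    refine hPK _ ?_
    have h := happrox k i y hyZ z hzZ
    have hFeq : F k y = F k z := funext fun j =>
      hφf y z ((Set.mem_singleton_iff.1 hy).trans (Set.mem_singleton_iff.1 hz).symm) j
    -- On a fibre `F k` is constant, so linear approximation says exactly that `T` nearly kills `y -
    -- z`.
    rw [hFeq, sub_self, zero_sub, norm_neg] at h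
    refine h.trans (le_of_eq ?_)
    simp only [hc, dif_pos hker]

theorem corollary1p8 (n m : ℕ) {X : Type*} [MetricSpace X] [MeasurableSpace X] [BorelSpace X]
    (A : Set (EuclideanSpace ℝ (Fin (n + m)))) (hA : NullMeasurableSet A volume)
    (f : A → X) (L : ℝ≥0) (hf : LipschitzWith L f)
    (hΘ : ∀ᵐ z ∂(volume : Measure (EuclideanSpace ℝ (Fin (n + m)))),
      ∀ hz : z ∈ A, 0 < upperDensity n f ⟨z, hz⟩) :
    ∀ᵐ x ∂(Measure.hausdorffMeasure (n : ℝ) : Measure X),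
      CountablyRectifiable m ((Subtype.val : A → EuclideanSpace ℝ (Fin (n + m))) '' (f ⁻¹' {x})) := by
  obtain ⟨Z, hZnull, hZ⟩ := exists_decomposition_of_upperDensity_pos n m hf hΘ
  set N := A \ ⋃ (k) (i), Z k i
  have hNA : N ⊆ A := Set.sdiff_subset
  have hfN : LipschitzWith (L * 1) (f ∘ Set.inclusion hNA) :=
    hf.comp (LipschitzWith.of_dist_le_mul fun y z => by simp [Subtype.dist_eq])
  filter_upwards [ae_hausdorffMeasure_fiber_eq_zero n m hfN hZnull] with x hx
  choose S g hg hsub using fun k i => hZ k i x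
  refine ⟨fun l => S l.unpair.1 l.unpair.2, fun l => g l.unpair.1 l.unpair.2,
    fun l => hg _ _, measure_mono_null ?_ hx⟩
  rintro _ ⟨⟨y, hy, rfl⟩, hyg⟩
  have hyN : (y : EuclideanSpace ℝ (Fin (n + m))) ∈ N := by
    refine ⟨y.2, fun hyZ => hyg ?_⟩
    obtain ⟨k, i, hki⟩ := Set.mem_iUnion₂.1 hyZ
    refine Set.mem_iUnion.2 ⟨Nat.pair k i, ?_⟩
    simp only [Nat.unpair_pair]
    exact hsub k i ⟨⟨y, hy, rfl⟩, hki⟩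
  exact ⟨⟨y, hyN⟩, hy, rfl⟩
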